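/- Let $A_1,A_2\in\mathbb R^{n\times n}$, $e_1,e_2,c\in\mathbb R^n$, $f\in\mathbb R$, and consider the bimodal piecewise affine system given by mode 1, $\dot x=A_1x+e_1$ where $c^Tx+f<0$, and mode 2, $\dot x=A_2x+e_2$ where $c^Tx+f>0$. A Filippov solution is a function $x:\mathbb R\to\mathbb R^n$, absolutely continuous on every compact interval, such that for almost every $t$ one has $\dot x(t)=A_1x(t)+e_1$ if $c^Tx(t)+f<0$, $\dot x(t)=A_2x(t)+e_2$ if $c^Tx(t)+f>0$, and $\dot x(t)\in\operatorname{conv}\{A_1x(t)+e_1,\,A_2x(t)+e_2\}$ if $c^Tx(t)+f=0$. A time $t^*$ is a non-switching time of $x$ if there exist $\epsilon>0$ and $i\in\{1,2\}$ such that $\dot x(t)=A_ix(t)+e_i$ and $(-1)^{i-1}(c^Tx(t)+f)\le 0$ for all $t\in(t^*-\epsilon,t^*+\epsilon)$; otherwise it is a switching time. A time $t^*$ is a left (respectively right) Zeno time of $x$ if for every $\epsilon>0$ the interval $(t^*,t^*+\epsilon)$ (respectively $(t^*-\epsilon,t^*)$) contains a switching time of $x$. The system is Zeno-free if no Filippov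 solution has a left or a right Zeno time. The observability index $h_i$ of $(c^T,A_i)$ is the largest integer $h_i\ge 0$ such that the matrix with rows $c^T,c^TA_i,\dots,c^TA_i^{h_i}$ has full row rank (it exists if and only if $c\neq 0$). **Theorem 5.** Suppose that the observability indices $h_1$ and $h_2$ exist and are the same, and let $h=h_1=h_2$. If there exists an $(h+2)\times(h+2)$ lower triangular matrix $M$ with positive diagonal elements such that $$\begin{bmatrix}c^T\\ c^TA_1\\ \vdots\\ c^TA_1^{h+1}\end{bmatrix}=M\begin{bmatrix}c^T\\ c^TA_2\\ \vdots\\ c^TA_2^{h+1}\end{bmatrix},\qquad \begin{bmatrix}f\\ c^Te_1\\ \vdots\\ c^TA_1^{h}e_1\end{bmatrix}=M\begin{bmatrix}f\\ c^Te_2\\ \vdots\\ c^TA_2^{h}e_2\end{bmatrix},$$ and if for every $\xi\in\mathbb R^n$ $$\begin{bmatrix}c^T\\ c^TA_1\\ \vdots\\ c^TA_1^{h+1}\end{bmatrix}\xi+\begin{bmatrix}f\\ c^Te_1\\ \vdots\\ c^TA_1^{h}e_1\end{bmatrix}=0\ \Longrightarrow\ A_1\xi+e_1=A_2\xi+e_2,$$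 then the system is Zeno-free. -/

import Mathlib

/-- `col(cᵀ, cᵀA, …, cᵀAᵏ)`, a matrix with `k + 1` rows. -/
def obsMatrix {n : ℕ} (c : Fin n → ℝ) (A : Matrix (Fin n) (Fin n) ℝ) (k : ℕ) :
    Matrix (Fin (k + 1)) (Fin n) ℝ :=
  Matrix.of fun j => Matrix.vecMul c (A ^ (j : ℕ))

/-- `col(f, cᵀe, cᵀAe, …, cᵀAᵏ⁻¹e)`, a vector with `k + 1` entries. -/
def offsetVector {n : ℕ} (c : Fin n → ℝ) (A : Matrix (Fin n) (Fin n) ℝ) (e : Fin n → ℝ) (f : ℝ)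
    (k : ℕ) : Fin (k + 1) → ℝ :=
  Fin.cons f fun j : Fin k => dotProduct c (Matrix.mulVec (A ^ (j : ℕ)) e)

/-- `h` is the observability index of `(cᵀ, A)`: the largest `h` such that
`col(cᵀ, cᵀA, …, cᵀAʰ)` has full row rank. (There is no such `h` when `c = 0`.) -/
def IsObservabilityIndex {n : ℕ} (c : Fin n → ℝ) (A : Matrix (Fin n) (Fin n) ℝ) (h : ℕ) : Prop :=
  IsGreatest {k : ℕ | (obsMatrix c A k).rank = k + 1} h

/-- `M` is lower triangular and its diagonal elements are positive. -/
def IsLowerTriangularPosDiag {m : ℕ} (M : Matrix (Fin m) (Fin m) ℝ) : Prop :=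
  M.IsLowerTriangular ∧ ∀ i, 0 < M i i

/-- The data of a bimodal piecewise affine system on `ℝⁿ`. -/
structure BimodalSystem (n : ℕ) where
  A₁ : Matrix (Fin n) (Fin n) ℝ
  A₂ : Matrix (Fin n) (Fin n) ℝ
  e₁ : Fin n → ℝ
  e₂ : Fin n → ℝ
  c : Fin n → ℝ
  f : ℝ

namespace BimodalSystem

variable {n : ℕ} (S : BimodalSystem n)

/-- The vector field of the first mode. -/
def field₁ (x : Fin n → ℝ) : Fin n → ℝ := Matrix.mulVec S.A₁ x + S.e₁

/-- The vector field of the second mode. -/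
def field₂ (x : Fin n → ℝ) : Fin n → ℝ := Matrix.mulVec S.A₂ x + S.e₂

/-- The switching function `cᵀx + f`. -/
def output (x : Fin n → ℝ) : ℝ := dotProduct S.c x + S.f

/-- The convexified set-valued right-hand side. -/
def convexified (x : Fin n → ℝ) : Set (Fin n → ℝ) :=
  {v | (S.output x < 0 ∧ v = S.field₁ x) ∨
    (S.output x = 0 ∧ v ∈ convexHull ℝ {S.field₁ x, S.field₂ x}) ∨
    (0 < S.output x ∧ v = S.field₂ x)}

/-- `x` is a Filippov solution for the initial state `ξ`: it is absolutely continuous on every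
compact interval, starts at `ξ`, and satisfies the convexified inclusion almost everywhere. -/
def IsFilippovSolution (ξ : Fin n → ℝ) (x : ℝ → Fin n → ℝ) : Prop :=
  (∀ a b : ℝ, AbsolutelyContinuousOnInterval x a b) ∧ x 0 = ξ ∧
    ∀ᵐ t : ℝ, ∃ v ∈ S.convexified (x t), HasDerivAt x v t

/-- At time `t`, `x` moves according to the first mode. -/
def FollowsMode₁At (x : ℝ → Fin n → ℝ) (t : ℝ) : Prop :=
  HasDerivAt x (S.field₁ (x t)) t ∧ S.output (x t) ≤ 0

/-- At time `t`, `x` moves according to the second mode. -/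
def FollowsMode₂At (x : ℝ → Fin n → ℝ) (t : ℝ) : Prop :=
  HasDerivAt x (S.field₂ (x t)) t ∧ 0 ≤ S.output (x t)

/-- `s` is a non-switching time for `x`: around `s`, `x` follows one and the same mode. -/
def IsNonSwitchingTime (x : ℝ → Fin n → ℝ) (s : ℝ) : Prop :=
  ∃ ε > 0, (∀ t ∈ Set.Ioo (s - ε) (s + ε), S.FollowsMode₁At x t) ∨
    ∀ t ∈ Set.Ioo (s - ε) (s + ε), S.FollowsMode₂At x t

/-- `s` is a switching time for `x`. -/
def IsSwitchingTime (x : ℝ → Fin n → ℝ) (s : ℝ) : Prop :=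
  ¬ S.IsNonSwitchingTime x s

/-- `s` is a left Zeno time for `x`. -/
def IsLeftZenoTime (x : ℝ → Fin n → ℝ) (s : ℝ) : Prop :=
  ∀ ε > 0, ∃ t ∈ Set.Ioo s (s + ε), S.IsSwitchingTime x t

/-- `s` is a right Zeno time for `x`. -/
def IsRightZenoTime (x : ℝ → Fin n → ℝ) (s : ℝ) : Prop :=
  ∀ ε > 0, ∃ t ∈ Set.Ioo (s - ε) s, S.IsSwitchingTime x t

/-- No Filippov solution has a left Zeno time. -/
def IsLeftZenoFree : Prop :=
  ∀ ξ x, S.IsFilippovSolution ξ x → ¬ ∃ s, S.IsLeftZenoTime x s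

/-- No Filippov solution has a right Zeno time. -/
def IsRightZenoFree : Prop :=
  ∀ ξ x, S.IsFilippovSolution ξ x → ¬ ∃ s, S.IsRightZenoTime x s

/-- The system is Zeno-free: both left and right Zeno-free. -/
def IsZenoFree : Prop :=
  S.IsLeftZenoFree ∧ S.IsRightZenoFree

end BimodalSystem

/-! Along a Filippov solution `x`, let `z j` be the `j`-th iterated output derivative of mode 1, so
that `z 0` is the switching function. Under mode 1 the derivative of `z j` is `z (j + 1)`. The
triangular relation shows that under mode 2 it is `M j j / M (j + 1) (j + 1) * z (j + 1)` plus a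
combination of `z 0, …, z j`. Hence, whichever convex combination of the modes is used, the
derivative of `z j` is a positive, uniformly bounded multiple of `z (j + 1)` up to lower terms
(`exists_isPerturbedChain`).

Fix a time `s`. If some `z j` with `j ≤ h + 1` is nonzero there, the first such `z k` dominates: `z
0` grows at least like `δ t ^ k` with the sign of `z k` (`exists_pow_le`), and one mode is followed
just after `s`. If all vanish, the observability index makes `z (h + 1)` a linear combination of the
others, and Gronwall keeps all of them zero (`eq_zero`); the two fields then agree along `x`. In
either case there is no switching just after `s`. Time reversal with alternating signs gives the
same conclusion before `s`. -/

open MeasureTheory Set Filter Topology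

/-! ### Perturbed chains: growth estimates and sign near an initial time. -/

/-- A family of functions `z j` with a.e. derivatives `d j` such that, for `j < N`, the derivative
of `z j` is a positive multiple of `z (j + 1)` up to an error controlled by `z 0, …, z j`. -/
structure IsPerturbedChain (N : ℕ) (C : ℝ) (z d : ℕ → ℝ → ℝ) : Prop where
  one_le : 1 ≤ C
  intervalIntegrable : ∀ j a b, IntervalIntegrable (d j) volume a b
  integral_eq : ∀ j a b, ∫ t in a..b, d j t = z j b - z j a
  deriv_bound : ∀ᵐ t, ∀ j < N, ∃ m ∈ Icc C⁻¹ C,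
    |d j t - m * z (j + 1) t| ≤ C * ∑ l ∈ Finset.range (j + 1), |z l t|

namespace IsPerturbedChain

variable {N : ℕ} {C : ℝ} {z d : ℕ → ℝ → ℝ}

theorem shift (H : IsPerturbedChain N C z d) (s : ℝ) :
    IsPerturbedChain N C (fun j t => z j (s + t)) (fun j t => d j (s + t)) where
  one_le := H.one_le
  intervalIntegrable j a b := by
    simpa using (H.intervalIntegrable j (s + a) (s + b)).comp_add_left s
  integral_eq j a b := by
    rw [intervalIntegral.integral_comp_add_left (d j) s, H.integral_eq]
  deriv_bound :=
    (measurePreserving_add_left volume s).quasiMeasurePreserving.ae H.deriv_bound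

/-- Reversing time changes the sign of each derivative; the alternating factors `(-1) ^ j` absorb
this change and keep the multipliers positive. -/
theorem reverse (H : IsPerturbedChain N C z d) (s : ℝ) :
    IsPerturbedChain N C (fun j t => (-1) ^ j * z j (s - t))
      (fun j t => (-1) ^ (j + 1) * d j (s - t)) where
  one_le := H.one_le
  intervalIntegrable j a b := by
    have h := (H.intervalIntegrable j (s - a) (s - b)).comp_sub_left s
    simp only [sub_sub_cancel] at h
    exact h.const_mul _
  integral_eq j a b := by
    rw [intervalIntegral.integral_const_mul, intervalIntegral.integral_comp_sub_left (d j) s,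
      H.integral_eq]
    ring
  deriv_bound := by
    have h := (Measure.measurePreserving_sub_left volume s).quasiMeasurePreserving.ae H.deriv_bound
    filter_upwards [h] with t ht j hj
    obtain ⟨m, hm, hb⟩ := ht j hj
    refine ⟨m, hm, ?_⟩
    simp only [abs_mul, abs_pow, abs_neg, abs_one, one_pow, one_mul]
    rw [show (-1 : ℝ) ^ (j + 1) * d j (s - t) - m * ((-1) ^ (j + 1) * z (j + 1) (s - t))
      = (-1) ^ (j + 1) * (d j (s - t) - m * z (j + 1) (s - t)) by ring, abs_mul]
    simpa using hb

theorem neg (H : IsPerturbedChain N C z d) :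
    IsPerturbedChain N C (fun j t => -z j t) (fun j t => -d j t) where
  one_le := H.one_le
  intervalIntegrable j a b := (H.intervalIntegrable j a b).neg
  integral_eq j a b := by rw [intervalIntegral.integral_neg, H.integral_eq]; ring
  deriv_bound := by
    filter_upwards [H.deriv_bound] with t ht j hj
    obtain ⟨m, hm, hb⟩ := ht j hj
    refine ⟨m, hm, ?_⟩
    simp only [abs_neg]
    rwa [show -d j t - m * -z (j + 1) t = -(d j t - m * z (j + 1) t) by ring, abs_neg]

theorem continuous (H : IsPerturbedChain N C z d) (j : ℕ) : Continuous (z j) := by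
  have h := (intervalIntegral.continuous_primitive (H.intervalIntegrable j) 0).add_const (z j 0)
  refine h.congr fun t => ?_
  rw [H.integral_eq]; ring

/-- Integration of an upper bound for the absolute value of the derivative. -/
theorem abs_sub_le (H : IsPerturbedChain N C z d) {j : ℕ} {t : ℝ} (ht : 0 ≤ t) {g : ℝ → ℝ}
    (hg : Continuous g) (h : ∀ᵐ s, s ∈ Ioc 0 t → |d j s| ≤ g s) :
    |z j t - z j 0| ≤ ∫ s in 0..t, g s := by
  rw [← H.integral_eq]
  exact intervalIntegral.norm_integral_le_of_norm_le (f := d j) ht h (hg.intervalIntegrable _ _)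

/-- Integration of a lower bound for the derivative. -/
theorem integral_le_sub (H : IsPerturbedChain N C z d) {j : ℕ} {t : ℝ} (ht : 0 ≤ t) {g : ℝ → ℝ}
    (hg : Continuous g) (h : ∀ᵐ s, s ∈ Ioc 0 t → g s ≤ d j s) :
    ∫ s in 0..t, g s ≤ z j t - z j 0 := by
  rw [← H.integral_eq, intervalIntegral.integral_of_le ht, intervalIntegral.integral_of_le ht]
  exact setIntegral_mono_on_ae (hg.intervalIntegrable _ _).1 (H.intervalIntegrable j 0 t).1
    measurableSet_Ioc h

theorem abs_deriv_le (H : IsPerturbedChain N C z d) :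
    ∀ᵐ t, ∀ j < N, |d j t| ≤ C * ∑ l ∈ Finset.range (j + 2), |z l t| := by
  filter_upwards [H.deriv_bound] with t ht j hj
  obtain ⟨m, ⟨hm0, hm1⟩, hb⟩ := ht j hj
  have hC := H.one_le
  have hm : 0 ≤ m := le_trans (by positivity) hm0
  rw [Finset.sum_range_succ, mul_add]
  calc |d j t| = |(d j t - m * z (j + 1) t) + m * z (j + 1) t| := by ring_nf
    _ ≤ _ := (abs_add_le _ _).trans (add_le_add hb (by
      rw [abs_mul, abs_of_nonneg hm]; gcongr))

/-- Bootstrapping: each round `r` integrates the derivative bound once from a zero initial value and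
gains one power of `t`. The gain stops at `k - j`, because `z k` itself is only bounded. -/
theorem exists_abs_le_pow (H : IsPerturbedChain N C z d) {k : ℕ} (hk : k ≤ N)
    (h0 : ∀ j < k, z j 0 = 0) (r : ℕ) :
    ∃ K, 0 ≤ K ∧ ∀ j ≤ k, ∀ t ∈ Icc (0 : ℝ) 1, |z j t| ≤ K * t ^ min r (k - j) := by
  induction r with
  | zero =>
    have hc : Continuous fun t => ∑ j ∈ Finset.range (k + 1), |z j t| :=
      continuous_finsetSum _ fun j _ => (H.continuous j).abs
    obtain ⟨K, hK⟩ := (isCompact_Icc (a := (0 : ℝ)) (b := 1)).exists_bound_of_continuousOn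
      hc.continuousOn
    refine ⟨K, (norm_nonneg _).trans (hK 0 (by simp)), fun j hj t ht => ?_⟩
    have h1 : |z j t| ≤ ∑ j ∈ Finset.range (k + 1), |z j t| :=
      Finset.single_le_sum (f := fun j => |z j t|) (fun _ _ => abs_nonneg _)
        (Finset.mem_range.2 (by omega))
    simpa using h1.trans ((le_abs_self _).trans (hK t ht))
  | succ r ih =>
    obtain ⟨K, hK0, hK⟩ := ih
    have hC := H.one_le
    -- The factor `k + 2` majorises the number `j + 2` of terms in the derivative bound; the extra
    -- `K` covers `j = k`, where nothing is integrated.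
    refine ⟨C * ((k + 2) * K) + K, by positivity, fun j hj t ht => ?_⟩
    rcases hj.eq_or_lt with rfl | hj
    · have := hK j le_rfl t ht
      simp only [tsub_self, zero_le, inf_of_le_right, pow_zero, mul_one] at this ⊢
      have : 0 ≤ C * ((j + 2) * K) := by positivity
      linarith
    · set q := min r (k - (j + 1)) with hq
      have hq' : min (r + 1) (k - j) = q + 1 := by omega
      have hd : ∀ᵐ s, s ∈ Ioc 0 t → |d j s| ≤ C * ((k + 2) * K) * t ^ q := by
        filter_upwards [H.abs_deriv_le] with s hs hst
        have hs1 : s ≤ 1 := hst.2.trans ht.2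
        refine (hs j (by omega)).trans ?_
        rw [mul_assoc]
        gcongr
        have hb : ∀ l ∈ Finset.range (j + 2), |z l s| ≤ K * t ^ q := fun l hl => by
          have hl := Finset.mem_range.1 hl
          refine (hK l (by omega) s ⟨hst.1.le, hs1⟩).trans ?_
          gcongr K * ?_
          exact (pow_le_pow_of_le_one hst.1.le hs1 (by omega)).trans
            (pow_le_pow_left₀ hst.1.le hst.2 q)
        refine (Finset.sum_le_card_nsmul _ _ _ hb).trans ?_
        have ht0 := ht.1
        have : (j : ℝ) ≤ k := by exact_mod_cast hj.le
        simp only [Finset.card_range, nsmul_eq_mul]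
        push_cast
        rw [mul_assoc]
        gcongr
      have h1 := H.abs_sub_le ht.1 continuous_const hd
      rw [h0 j hj, intervalIntegral.integral_const, smul_eq_mul, sub_zero, sub_zero] at h1
      rw [hq']
      calc |z j t| ≤ t * (C * ((k + 2) * K) * t ^ q) := h1
        _ = C * ((k + 2) * K) * t ^ (q + 1) := by ring
        _ ≤ _ := by have := ht.1; gcongr; linarith

/-- Positivity of `z k` descends the chain by integration: with `j = k - (i + 1)`, the main term of
the derivative of `z j` is at least of order `t ^ i`, while `exists_abs_le_pow` makes the error of
order `t ^ (i + 1)`. -/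
theorem exists_pow_le (H : IsPerturbedChain N C z d) {k : ℕ} (hk : k ≤ N)
    (h0 : ∀ j < k, z j 0 = 0) (hpos : 0 < z k 0) (i : ℕ) (hi : i ≤ k) :
    ∃ δ > 0, ∃ ε ∈ Ioc (0 : ℝ) 1, ∀ t ∈ Icc 0 ε, δ * t ^ i ≤ z (k - i) t := by
  obtain ⟨K, hK0, hK⟩ := H.exists_abs_le_pow hk h0 k
  have hC := H.one_le
  induction i with
  | zero =>
    have hev : ∀ᶠ t in 𝓝 (0 : ℝ), z k 0 / 2 < z k t :=
      (H.continuous k).continuousAt.eventually_const_lt (by linarith)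
    obtain ⟨ε, hε, hb⟩ := Metric.eventually_nhds_iff.1 hev
    refine ⟨z k 0 / 2, by linarith, min (ε / 2) 1, ⟨by positivity, min_le_right _ _⟩,
      fun t ht => ?_⟩
    have h1 := ht.2.trans (min_le_left _ _)
    simpa using (hb (y := t) (by rw [Real.dist_eq, sub_zero, abs_of_nonneg ht.1]; linarith)).le
  | succ i ih =>
    obtain ⟨δ, hδ, ε, hε, hb⟩ := ih (by omega)
    set j := k - (i + 1) with hj
    have hj1 : k - i = j + 1 := by omega
    rw [hj1] at hb
    -- `B * s ^ (i + 1)` bounds the error, and `ε'` is small enough for it to consume at most half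
    -- of the main term. The `+ 1` permits division by `B` when `K = 0`.
    set B : ℝ := C * ((k + 1) * K) + 1 with hB
    have hBpos : 0 < B := by positivity
    set ε' := min ε (C⁻¹ * δ / 2 / B) with hε'
    have hε'pos : 0 < ε' := lt_min hε.1 (by positivity)
    refine ⟨C⁻¹ * δ / 2 / (i + 1), by positivity, ε', ⟨hε'pos, (min_le_left _ _).trans hε.2⟩,
      fun t ht => ?_⟩
    have hd : ∀ᵐ s, s ∈ Ioc 0 t → C⁻¹ * δ / 2 * s ^ i ≤ d j s := by
      filter_upwards [H.deriv_bound] with s hs hst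
      obtain ⟨m, ⟨hm0, hm1⟩, hdm⟩ := hs j (by omega)
      have hs0 := hst.1.le
      have hsε : s ≤ ε := hst.2.trans (ht.2.trans (min_le_left _ _))
      have hsB : s ≤ C⁻¹ * δ / 2 / B := hst.2.trans (ht.2.trans (min_le_right _ _))
      have hs1 : s ≤ 1 := hsε.trans hε.2
      have hz := hb s ⟨hs0, hsε⟩
      have hsum : ∑ l ∈ Finset.range (j + 1), |z l s| ≤ (k + 1) * K * s ^ (i + 1) := by
        have hb : ∀ l ∈ Finset.range (j + 1), |z l s| ≤ K * s ^ (i + 1) := fun l hl => by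
          have hl := Finset.mem_range.1 hl
          refine (hK l (by omega) s ⟨hs0, hs1⟩).trans ?_
          gcongr K * ?_
          exact pow_le_pow_of_le_one hs0 hs1 (by omega)
        refine (Finset.sum_le_card_nsmul _ _ _ hb).trans ?_
        have : (j : ℝ) ≤ k := by exact_mod_cast (show j ≤ k by omega)
        simp only [Finset.card_range, nsmul_eq_mul]
        push_cast
        rw [mul_assoc]
        gcongr
      have h1 : C⁻¹ * (δ * s ^ i) ≤ m * z (j + 1) s := by
        have : 0 ≤ δ * s ^ i := by positivity
        have : 0 ≤ m := le_trans (by positivity) hm0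
        gcongr
      have h2 : C * ∑ l ∈ Finset.range (j + 1), |z l s| ≤ C⁻¹ * δ / 2 * s ^ i := by
        calc _ ≤ C * ((k + 1) * K * s ^ (i + 1)) := by gcongr
          _ = (C * ((k + 1) * K) * s) * s ^ i := by ring
          _ ≤ (B * s) * s ^ i := by gcongr; linarith
          _ ≤ _ := by
            gcongr
            rwa [le_div_iff₀ hBpos, mul_comm] at hsB
      have h3 := (abs_le.1 hdm).1
      nlinarith
    have h1 := H.integral_le_sub ht.1 (by fun_prop) hd
    rw [h0 j (by omega), intervalIntegral.integral_const_mul, integral_pow] at h1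
    simp only [ne_eq, Nat.add_eq_zero_iff, one_ne_zero, and_false, not_false_eq_true, zero_pow,
      sub_zero] at h1
    calc _ = C⁻¹ * δ / 2 * (t ^ (i + 1) / (i + 1)) := by ring
      _ ≤ _ := h1

theorem eventually_pos (H : IsPerturbedChain N C z d) {k : ℕ} (hk : k ≤ N)
    (h0 : ∀ j < k, z j 0 = 0) (hpos : 0 < z k 0) : ∃ ε > 0, ∀ t ∈ Ioo 0 ε, 0 < z 0 t := by
  obtain ⟨δ, hδ, ε, hε, hb⟩ := H.exists_pow_le hk h0 hpos k le_rfl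
  refine ⟨ε, hε.1, fun t ht => ?_⟩
  have h1 := hb t ⟨ht.1.le, ht.2.le⟩
  rw [tsub_self] at h1
  exact lt_of_lt_of_le (mul_pos hδ (pow_pos ht.1 k)) h1

/-- The bound `hD` closes the chain, so `w`, the sum of the `|z l|`, is dominated by a multiple of
its own integral. Gronwall is applied to that integral, which is differentiable everywhere, unlike
`w`. -/
theorem eq_zero (H : IsPerturbedChain N C z d) {D : ℝ}
    (hD : ∀ t, |z N t| ≤ D * ∑ l ∈ Finset.range N, |z l t|) (h0 : ∀ j < N, z j 0 = 0)
    {t : ℝ} (ht : 0 ≤ t) {j : ℕ} (hj : j ≤ N) : z j t = 0 := by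
  have hC := H.one_le
  set w : ℝ → ℝ := fun t => ∑ l ∈ Finset.range N, |z l t| with hw
  have hw0 : ∀ t, 0 ≤ w t := fun t => Finset.sum_nonneg fun _ _ => abs_nonneg _
  have hwc : Continuous w := continuous_finsetSum _ fun j _ => (H.continuous j).abs
  set B := C * (1 + |D|)
  have hle : ∀ t, 0 ≤ t → w t ≤ N * B * ∫ s in 0..t, w s := fun t ht => by
    have hj : ∀ j ∈ Finset.range N, |z j t| ≤ B * ∫ s in 0..t, w s := fun j hj => by
      have hj := Finset.mem_range.1 hj
      have := H.abs_sub_le (j := j) ht (g := fun s => B * w s) (by fun_prop) (by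
        filter_upwards [H.abs_deriv_le] with s hs _
        refine (hs j hj).trans ?_
        rw [mul_assoc]
        gcongr
        calc ∑ l ∈ Finset.range (j + 2), |z l s| ≤ ∑ l ∈ Finset.range (N + 1), |z l s| :=
              Finset.sum_le_sum_of_subset_of_nonneg (Finset.range_mono (by omega))
                fun _ _ _ => abs_nonneg _
          _ = w s + |z N s| := Finset.sum_range_succ _ _
          _ ≤ w s + |D| * w s := by
            gcongr
            exact (hD s).trans (mul_le_mul_of_nonneg_right (le_abs_self D) (hw0 s))
          _ = (1 + |D|) * w s := by ring)
      rwa [h0 j hj, sub_zero, intervalIntegral.integral_const_mul] at this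
    simpa [mul_assoc] using Finset.sum_le_card_nsmul _ _ _ hj
  have hG : ∀ t, HasDerivAt (fun t => ∫ s in 0..t, w s) (w t) t := fun t =>
    intervalIntegral.integral_hasDerivAt_right (hwc.intervalIntegrable _ _)
      (hwc.stronglyMeasurableAtFilter _ _) hwc.continuousAt
  have hzero := norm_le_gronwallBound_of_norm_deriv_right_le (a := 0) (b := t + 1) (δ := 0)
    (K := N * B) (ε := 0) (f := fun t => ∫ s in 0..t, w s) (f' := w)
    (fun x _ => (hG x).continuousAt.continuousWithinAt) (fun x _ => (hG x).hasDerivWithinAt)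
    (by simp) (fun x hx => by
      rw [Real.norm_of_nonneg (hw0 x), add_zero, Real.norm_of_nonneg
        (intervalIntegral.integral_nonneg hx.1 fun s _ => hw0 s)]
      exact hle x hx.1) t ⟨ht, by linarith⟩
  have hI : ∫ s in 0..t, w s = 0 := by
    rw [gronwallBound_ε0_δ0] at hzero
    exact norm_le_zero_iff.1 hzero
  have hwt : w t = 0 := le_antisymm (by simpa [hI] using hle t ht) (hw0 t)
  rcases hj.eq_or_lt with rfl | hj
  · have := hD t
    change _ ≤ D * w t at this
    rw [hwt, mul_zero] at this
    exact abs_nonpos_iff.1 this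
  · have := (Finset.sum_eq_zero_iff_of_nonneg fun _ _ => abs_nonneg _).1 hwt j
      (Finset.mem_range.2 hj)
    exact abs_eq_zero.1 this

/-- Just after time `0`, the leading function of a perturbed chain has a constant sign, unless the
whole chain vanishes. -/
theorem trichotomy (H : IsPerturbedChain N C z d)
    (hD : (∀ j ≤ N, z j 0 = 0) → ∃ D, ∀ t, |z N t| ≤ D * ∑ l ∈ Finset.range N, |z l t|) :
    (∃ ε > 0, ∀ t ∈ Ioo 0 ε, z 0 t < 0) ∨ (∃ ε > 0, ∀ t ∈ Ioo 0 ε, 0 < z 0 t) ∨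
      ∀ t, 0 ≤ t → ∀ j ≤ N, z j t = 0 := by
  by_cases hall : ∀ j ≤ N, z j 0 = 0
  · obtain ⟨D, hD⟩ := hD hall
    exact Or.inr (Or.inr fun t ht j hj => H.eq_zero hD (fun j hj => hall j hj.le) ht hj)
  · push Not at hall
    classical
    obtain ⟨hk, hne⟩ := Nat.find_spec hall
    have hmin : ∀ j < Nat.find hall, z j 0 = 0 := fun j hj => by
      have := Nat.find_min hall hj
      push Not at this
      exact this (by omega)
    rcases lt_or_gt_of_ne hne with hlt | hgt
    · obtain ⟨ε, hε, hb⟩ := H.neg.eventually_pos hk (fun j hj => by simp [hmin j hj])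
        (by simpa using hlt)
      exact Or.inl ⟨ε, hε, fun t ht => by simpa using hb t ht⟩
    · exact Or.inr (Or.inl (H.eventually_pos hk hmin hgt))

end IsPerturbedChain

/-! ### Estimates for lower triangular systems. -/

theorem exists_forall_lt_of_monotone {P : ℕ → ℝ → Prop}
    (hP : ∀ j C C', 1 ≤ C → C ≤ C' → P j C → P j C') (h : ∀ j, ∃ C, 1 ≤ C ∧ P j C) (N : ℕ) :
    ∃ C, 1 ≤ C ∧ ∀ j < N, P j C := by
  induction N with
  | zero => exact ⟨1, le_rfl, by simp⟩
  | succ N ih =>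
    obtain ⟨C, hC1, hC⟩ := ih
    obtain ⟨C', hC1', hC'⟩ := h N
    refine ⟨max C C', le_max_of_le_left hC1, fun j hj => ?_⟩
    rcases (Nat.lt_succ_iff.1 hj).eq_or_lt with rfl | hj
    · exact hP _ _ _ hC1' (le_max_right _ _) hC'
    · exact hP _ _ _ hC1 (le_max_left _ _) (hC j hj)

theorem abs_sum_mul_le {s : Finset ℕ} {u v : ℕ → ℝ} {B : ℝ} (h : ∀ l ∈ s, |v l| ≤ B) :
    |∑ l ∈ s, u l * v l| ≤ (∑ l ∈ s, |u l|) * B := by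
  rw [Finset.sum_mul]
  refine (Finset.abs_sum_le_sum_abs _ _).trans (Finset.sum_le_sum fun l hl => ?_)
  rw [abs_mul]
  exact mul_le_mul_of_nonneg_left (h l hl) (abs_nonneg _)

section Triangular

variable {M : ℕ → ℕ → ℝ}

theorem sum_range_abs_mono (a : ℕ → ℝ) {i j : ℕ} (h : i ≤ j) :
    ∑ l ∈ Finset.range i, |a l| ≤ ∑ l ∈ Finset.range j, |a l| :=
  Finset.sum_le_sum_of_subset_of_nonneg (Finset.range_mono h) fun _ _ _ => abs_nonneg _

/-- The solution of a lower triangular system is bounded, row by row, by the right-hand side. -/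
theorem exists_abs_le_of_triangular (hM : ∀ i, 0 < M i i) (j : ℕ) :
    ∃ C, 0 ≤ C ∧ ∀ a b : ℕ → ℝ, (∀ i < j, a i = ∑ l ∈ Finset.range (i + 1), M i l * b l) →
      ∀ i < j, |b i| ≤ C * ∑ l ∈ Finset.range (i + 1), |a l| := by
  induction j with
  | zero => exact ⟨0, le_rfl, by simp⟩
  | succ j ih =>
    obtain ⟨C, hC0, hC⟩ := ih
    set R := ∑ l ∈ Finset.range j, |M j l|
    have hR : 0 ≤ R := Finset.sum_nonneg fun _ _ => abs_nonneg _
    have hj0 := hM j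
    -- Forward substitution: row `j` is solved for `b j`, the earlier `b l` being bounded by
    -- induction.
    refine ⟨C + (1 + R * C) / M j j, by positivity, fun a b hab i hi => ?_⟩
    have hS : ∀ i, 0 ≤ ∑ l ∈ Finset.range i, |a l| := fun i =>
      Finset.sum_nonneg fun _ _ => abs_nonneg _
    have hlow := hC a b fun i hi => hab i (by omega)
    rcases (Nat.lt_succ_iff.1 hi).eq_or_lt with rfl | hi
    · have h1 := hab i (by omega)
      rw [Finset.sum_range_succ] at h1
      have h2 : |∑ l ∈ Finset.range i, M i l * b l| ≤
          R * (C * ∑ l ∈ Finset.range (i + 1), |a l|) :=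
        abs_sum_mul_le fun l hl => by
          have hl := Finset.mem_range.1 hl
          refine (hlow l hl).trans ?_
          gcongr
      have h3 : |a i| ≤ ∑ l ∈ Finset.range (i + 1), |a l| :=
        Finset.single_le_sum (f := fun l => |a l|) (fun _ _ => abs_nonneg _) (by simp)
      have h4 : |b i| * M i i ≤ (1 + R * C) * ∑ l ∈ Finset.range (i + 1), |a l| := by
        rw [show |b i| * M i i = |b i * M i i| by rw [abs_mul, abs_of_pos hj0],
          show b i * M i i = a i - ∑ l ∈ Finset.range i, M i l * b l by linarith]
        refine (abs_sub _ _).trans ?_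
        linarith
      rw [← le_div_iff₀ hj0] at h4
      have h5 := mul_nonneg hC0 (hS (i + 1))
      calc _ ≤ _ := h4
        _ ≤ _ := by rw [add_mul C, div_mul_eq_mul_div]; linarith
    · refine (hlow i hi).trans ?_
      have := hS (i + 1)
      gcongr
      have : 0 ≤ (1 + R * C) / M j j := by positivity
      linarith

/-- If `a = M b` with `M` lower triangular, then the row `j` of `M` applied to the shift of `b` is
a positive multiple of `a (j + 1)` up to an error controlled by `a 0, …, a j`. -/
theorem exists_abs_sub_le_of_triangular (hM : ∀ i, 0 < M i i) (j : ℕ) :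
    ∃ C, 0 ≤ C ∧ ∀ a b : ℕ → ℝ,
      (∀ i < j + 2, a i = ∑ l ∈ Finset.range (i + 1), M i l * b l) →
      |∑ l ∈ Finset.range (j + 1), M j l * b (l + 1) - M j j / M (j + 1) (j + 1) * a (j + 1)| ≤
        C * ∑ l ∈ Finset.range (j + 1), |a l| := by
  obtain ⟨C, hC0, hC⟩ := exists_abs_le_of_triangular hM (j + 1)
  set R := ∑ l ∈ Finset.range j, |M j l|
  set R' := ∑ l ∈ Finset.range (j + 1), |M (j + 1) l|
  have hR : 0 ≤ R := Finset.sum_nonneg fun _ _ => abs_nonneg _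
  have hR' : 0 ≤ R' := Finset.sum_nonneg fun _ _ => abs_nonneg _
  have hj0 := hM j
  have hj1 := hM (j + 1)
  refine ⟨R * C + M j j / M (j + 1) (j + 1) * (R' * C), by positivity, fun a b hab => ?_⟩
  set T := ∑ l ∈ Finset.range (j + 1), |a l|
  have hlow : ∀ i < j + 1, |b i| ≤ C * T := fun i hi =>
    (hC a b (fun i hi => hab i (by omega)) i hi).trans
      (mul_le_mul_of_nonneg_left (sum_range_abs_mono a (by omega)) hC0)
  have h1 : |∑ l ∈ Finset.range j, M j l * b (l + 1)| ≤ R * (C * T) :=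
    abs_sum_mul_le (v := fun l => b (l + 1)) fun l hl =>
      hlow _ (by have := Finset.mem_range.1 hl; omega)
  have h2 : |∑ l ∈ Finset.range (j + 1), M (j + 1) l * b l| ≤ R' * (C * T) :=
    abs_sum_mul_le fun l hl => hlow _ (Finset.mem_range.1 hl)
  have h3 := hab (j + 1) (by omega)
  rw [Finset.sum_range_succ] at h3
  -- The multiplier is chosen so that the `b (j + 1)` terms cancel; only `b 0, …, b j` remain, and
  -- these are controlled by `a 0, …, a j`.
  have h4 : ∑ l ∈ Finset.range (j + 1), M j l * b (l + 1) -
      M j j / M (j + 1) (j + 1) * a (j + 1) = ∑ l ∈ Finset.range j, M j l * b (l + 1) -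
      M j j / M (j + 1) (j + 1) * ∑ l ∈ Finset.range (j + 1), M (j + 1) l * b l := by
    rw [h3, Finset.sum_range_succ (fun l => M j l * b (l + 1))]
    field_simp
    ring
  rw [h4]
  refine (abs_sub _ _).trans ?_
  rw [abs_mul, abs_of_pos (div_pos hj0 hj1)]
  have := mul_le_mul_of_nonneg_left h2 (div_pos hj0 hj1).le
  linarith

/-- A uniform version of the previous bound, for convex combinations with the shift of `a`. -/
theorem exists_abs_convex_sub_le_of_triangular (hM : ∀ i, 0 < M i i) (N : ℕ) :
    ∃ C, 1 ≤ C ∧ ∀ j < N, ∀ a b : ℕ → ℝ,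
      (∀ i < j + 2, a i = ∑ l ∈ Finset.range (i + 1), M i l * b l) →
      ∀ θ θ' : ℝ, 0 ≤ θ → 0 ≤ θ' → θ + θ' = 1 → ∃ m ∈ Icc C⁻¹ C,
        |θ * a (j + 1) + θ' * ∑ l ∈ Finset.range (j + 1), M j l * b (l + 1) - m * a (j + 1)| ≤
          C * ∑ l ∈ Finset.range (j + 1), |a l| := by
  refine exists_forall_lt_of_monotone (fun j C C' hC hCC' h a b hab θ θ' h0 h0' h1 => ?_)
    (fun j => ?_) N
  · obtain ⟨m, hm, hb⟩ := h a b hab θ θ' h0 h0' h1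
    refine ⟨m, ⟨(inv_anti₀ (by positivity) hCC').trans hm.1, hm.2.trans hCC'⟩, hb.trans ?_⟩
    have : 0 ≤ ∑ l ∈ Finset.range (j + 1), |a l| := Finset.sum_nonneg fun _ _ => abs_nonneg _
    gcongr
  · obtain ⟨C, hC0, hC⟩ := exists_abs_sub_le_of_triangular hM j
    set r := M j j / M (j + 1) (j + 1) with hr
    have hr0 : 0 < r := div_pos (hM j) (hM (j + 1))
    -- Both `r` and `r⁻¹` are included so that `r`, and by convexity `θ + θ' * r`, lies between
    -- `D⁻¹` and `D`.
    set D := 1 + C + r + r⁻¹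
    have hD : 1 ≤ D := by
      have : 0 < r⁻¹ := by positivity
      linarith
    have hrD : r ∈ Icc D⁻¹ D := by
      have : 0 < r⁻¹ := by positivity
      refine ⟨inv_le_of_inv_le₀ hr0 ?_, ?_⟩ <;> linarith
    have h1D : (1 : ℝ) ∈ Icc D⁻¹ D := ⟨inv_le_one_of_one_le₀ hD, hD⟩
    refine ⟨D, hD, fun a b hab θ θ' h0 h0' h1 =>
      ⟨θ * 1 + θ' * r, convex_Icc _ _ h1D hrD h0 h0' h1, ?_⟩⟩
    rw [show ∀ X, θ * a (j + 1) + θ' * X - (θ * 1 + θ' * r) * a (j + 1) =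
      θ' * (X - r * a (j + 1)) by intro X; ring, abs_mul, abs_of_nonneg h0']
    have hS : 0 ≤ ∑ l ∈ Finset.range (j + 1), |a l| := Finset.sum_nonneg fun _ _ => abs_nonneg _
    calc _ ≤ 1 * (C * ∑ l ∈ Finset.range (j + 1), |a l|) := by
          gcongr
          · linarith
          · exact hC a b hab
      _ ≤ _ := by
        rw [one_mul]
        gcongr
        have : 0 < r⁻¹ := by positivity
        linarith

end Triangular

/-! ### Row dependence from the observability index; absolutely continuous solutions. -/

/-- If `col(cᵀ, …, cᵀAᵏ)` has full row rank for `k = h` but not for `k = h + 1`, then `cᵀAʰ⁺¹` is a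
combination of the previous rows. -/
theorem IsObservabilityIndex.exists_vecMul_pow_eq_sum {n : ℕ} {c : Fin n → ℝ}
    {A : Matrix (Fin n) (Fin n) ℝ} {h : ℕ} (H : IsObservabilityIndex c A h) :
    ∃ α : Fin (h + 1) → ℝ,
      ∑ i, α i • Matrix.vecMul c (A ^ (i : ℕ)) = Matrix.vecMul c (A ^ (h + 1)) := by
  rw [← Submodule.mem_span_range_iff_exists_fun]
  by_contra hnot
  have hli : LinearIndependent ℝ (obsMatrix c A h).row := by
    rw [linearIndependent_iff_card_eq_finrank_span, Set.finrank,
      ← Matrix.rank_eq_finrank_span_row, Fintype.card_fin]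
    exact H.1.symm
  have hli' : LinearIndependent ℝ (obsMatrix c A (h + 1)).row := by
    rw [linearIndependent_finSucc']
    exact ⟨hli, hnot⟩
  have hmem : h + 1 ∈ {k : ℕ | (obsMatrix c A k).rank = k + 1} := by
    simpa using hli'.rank_matrix
  have := H.2 hmem
  omega

theorem LipschitzWith.comp_absolutelyContinuousOnInterval {X Y : Type*} [PseudoMetricSpace X]
    [PseudoMetricSpace Y] {g : X → Y} {K : NNReal} (hg : LipschitzWith K g) {f : ℝ → X} {a b : ℝ}
    (hf : AbsolutelyContinuousOnInterval f a b) :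
    AbsolutelyContinuousOnInterval (fun t => g (f t)) a b := by
  have hK : Tendsto _ _ (𝓝 ((K : ℝ) * 0)) := Tendsto.const_mul (K : ℝ) hf
  rw [mul_zero] at hK
  refine squeeze_zero (fun t => Finset.sum_nonneg fun _ _ => dist_nonneg) (fun t => ?_) hK
  rw [Finset.mul_sum]
  exact Finset.sum_le_sum fun _ _ => hg.dist_le_mul _ _

theorem continuous_of_forall_absolutelyContinuousOnInterval {F : Type*}
    [SeminormedAddCommGroup F] {f : ℝ → F} (hf : ∀ a b, AbsolutelyContinuousOnInterval f a b) :
    Continuous f := by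
  refine continuous_iff_continuousAt.2 fun t => ?_
  have h := (hf (t - 1) (t + 1)).continuousOn
  rw [uIcc_of_le (by linarith)] at h
  exact h.continuousAt (Icc_mem_nhds (by linarith) (by linarith))

/-- An absolutely continuous function that solves `x' = F x` almost everywhere on an open interval,
with `F` continuous, solves it everywhere on this interval. -/
theorem hasDerivAt_of_ae_hasDerivAt {n : ℕ} {x : ℝ → Fin n → ℝ} {F : (Fin n → ℝ) → Fin n → ℝ}
    (hF : Continuous F) (hx : ∀ a b, AbsolutelyContinuousOnInterval x a b) {a b : ℝ}
    (h : ∀ᵐ t, t ∈ Ioo a b → HasDerivAt x (F (x t)) t) {t : ℝ} (ht : t ∈ Ioo a b) :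
    HasDerivAt x (F (x t)) t := by
  have hxc := continuous_of_forall_absolutelyContinuousOnInterval hx
  refine hasDerivAt_pi.2 fun i => ?_
  have hFi : Continuous fun s => F (x s) i := (continuous_apply i).comp (hF.comp hxc)
  have hI : HasDerivAt (fun u => (∫ s in t..u, F (x s) i) + x t i) (F (x t) i) t :=
    (intervalIntegral.integral_hasDerivAt_right (hFi.intervalIntegrable _ _)
      (hFi.stronglyMeasurableAtFilter _ _) hFi.continuousAt).add_const _
  refine hI.congr_of_eventuallyEq ?_
  filter_upwards [Ioo_mem_nhds ht.1 ht.2] with u hu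
  have hac := (LipschitzWith.eval i).comp_absolutelyContinuousOnInterval (hx t u)
  have hint := hac.integral_deriv_eq_sub
  have hcongr : ∫ s in t..u, deriv (fun s => x s i) s = ∫ s in t..u, F (x s) i := by
    refine intervalIntegral.integral_congr_ae ?_
    filter_upwards [h] with s hs hsu
    exact (hasDerivAt_pi.1 (hs (ordConnected_Ioo.uIcc_subset ht hu (uIoc_subset_uIcc hsu))) i).deriv
  have hint' : ∫ s in t..u, deriv (fun s => x s i) s = x u i - x t i := hint
  change x u i = _
  rw [← hcongr, hint']
  ring

/-! ### Iterated derivatives of the output. -/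

section Output

variable {n : ℕ} (c : Fin n → ℝ) (A : Matrix (Fin n) (Fin n) ℝ) (e : Fin n → ℝ) (f : ℝ)

/-- The linear functional `v ↦ cᵀAʲv`. -/
def obsFunctional (j : ℕ) : (Fin n → ℝ) →ₗ[ℝ] ℝ where
  toFun v := dotProduct (Matrix.vecMul c (A ^ j)) v
  map_add' := dotProduct_add _
  map_smul' r := dotProduct_smul r _

/-- The iterated derivatives of the output `cᵀξ + f` along the affine vector field `Aξ + e`. -/
def outputDeriv : ℕ → (Fin n → ℝ) → ℝ
  | 0, ξ => dotProduct c ξ + f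
  | j + 1, ξ => obsFunctional c A j (Matrix.mulVec A ξ + e)

variable {c A e f}

theorem obsFunctional_mulVec (j : ℕ) (v : Fin n → ℝ) :
    obsFunctional c A j (Matrix.mulVec A v) = obsFunctional c A (j + 1) v := by
  simp only [obsFunctional, LinearMap.coe_mk, AddHom.coe_mk]
  rw [Matrix.dotProduct_mulVec, Matrix.vecMul_vecMul, pow_succ]

theorem outputDeriv_sub (j : ℕ) (ξ η : Fin n → ℝ) :
    outputDeriv c A e f j ξ - outputDeriv c A e f j η = obsFunctional c A j (ξ - η) := by
  cases j with
  | zero => simp [outputDeriv, obsFunctional, dotProduct_sub]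
  | succ j =>
    simp only [outputDeriv]
    rw [← map_sub, ← obsFunctional_mulVec, add_sub_add_right_eq_sub, Matrix.mulVec_sub]

theorem obsMatrix_mulVec_add_offsetVector (k : ℕ) (ξ : Fin n → ℝ) (i : Fin (k + 1)) :
    (Matrix.mulVec (obsMatrix c A k) ξ + offsetVector c A e f k) i = outputDeriv c A e f i ξ := by
  refine Fin.cases ?_ (fun j => ?_) i
  · simp [obsMatrix, offsetVector, outputDeriv, Matrix.mulVec]
  · simp only [Fin.val_succ, outputDeriv, map_add, obsFunctional_mulVec]
    simp [obsMatrix, offsetVector, Matrix.mulVec, obsFunctional, Matrix.dotProduct_mulVec]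

theorem continuous_affineField : Continuous fun ξ : Fin n → ℝ => Matrix.mulVec A ξ + e :=
  (continuous_const.matrix_mulVec continuous_id).add continuous_const

theorem exists_lipschitzWith_outputDeriv (j : ℕ) :
    ∃ K, LipschitzWith K (outputDeriv c A e f j) := by
  refine ⟨‖LinearMap.toContinuousLinearMap (obsFunctional c A j)‖₊,
    LipschitzWith.of_dist_le_mul fun ξ η => ?_⟩
  rw [Real.dist_eq, outputDeriv_sub, dist_eq_norm]
  exact (LinearMap.toContinuousLinearMap (obsFunctional c A j)).le_opNorm (ξ - η)

theorem hasDerivAt_outputDeriv {x : ℝ → Fin n → ℝ} {v : Fin n → ℝ} {t : ℝ}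
    (hx : HasDerivAt x v t) (j : ℕ) :
    HasDerivAt (fun t => outputDeriv c A e f j (x t)) (obsFunctional c A j v) t := by
  have h := (LinearMap.toContinuousLinearMap (obsFunctional c A j)).hasFDerivAt.comp_hasDerivAt t hx
  refine (h.add_const (outputDeriv c A e f j 0)).congr_of_eventuallyEq (Eventually.of_forall ?_)
  intro s
  have := outputDeriv_sub (c := c) (A := A) (e := e) (f := f) j (x s) 0
  rw [sub_zero] at this
  simpa using sub_eq_iff_eq_add.1 this

/-- Near a common zero of all the iterated derivatives of the output, the last of them is a
combination of the others. -/
theorem exists_abs_outputDeriv_le {h : ℕ} (H : IsObservabilityIndex c A h) {η : Fin n → ℝ}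
    (hη : ∀ j ≤ h + 1, outputDeriv c A e f j η = 0) :
    ∃ D, ∀ ξ, |outputDeriv c A e f (h + 1) ξ| ≤
      D * ∑ l ∈ Finset.range (h + 1), |outputDeriv c A e f l ξ| := by
  obtain ⟨α, hα⟩ := H.exists_vecMul_pow_eq_sum
  refine ⟨∑ i, |α i|, fun ξ => ?_⟩
  -- Taking the common zero `η` as origin makes these affine functions linear, so the row dependence
  -- carries over without a constant term.
  have heq : ∀ j ≤ h + 1, outputDeriv c A e f j ξ = obsFunctional c A j (ξ - η) := fun j hj => by
    rw [← outputDeriv_sub (e := e) (f := f), hη j hj, sub_zero]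
  have hsum : outputDeriv c A e f (h + 1) ξ = ∑ i, α i * outputDeriv c A e f i ξ := by
    rw [heq _ le_rfl]
    change dotProduct (Matrix.vecMul c (A ^ (h + 1))) _ = _
    rw [← hα, sum_dotProduct]
    refine Finset.sum_congr rfl fun i _ => ?_
    rw [heq i (by omega), smul_dotProduct]
    rfl
  rw [hsum, Finset.sum_mul]
  refine (Finset.abs_sum_le_sum_abs _ _).trans (Finset.sum_le_sum fun i _ => ?_)
  rw [abs_mul]
  gcongr
  exact Finset.single_le_sum (f := fun l => |outputDeriv c A e f l ξ|) (fun _ _ => abs_nonneg _)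
    (Finset.mem_range.2 i.2)

end Output

/-! ### The bimodal system: its chain and its non-switching times. -/

/-- The extension by the identity of a finite square matrix to a matrix indexed by `ℕ`. -/
def extendByOne {m : ℕ} (M : Matrix (Fin m) (Fin m) ℝ) (i j : ℕ) : ℝ :=
  if h : i < m ∧ j < m then M ⟨i, h.1⟩ ⟨j, h.2⟩ else if i = j then 1 else 0

/-- The triangular estimates ask for positive diagonal entries at every natural index; this is why
the extension is by the identity and not by zero. -/
theorem extendByOne_diag_pos {m : ℕ} {M : Matrix (Fin m) (Fin m) ℝ} (hM : ∀ i, 0 < M i i)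
    (i : ℕ) : 0 < extendByOne M i i := by
  unfold extendByOne
  split_ifs
  · exact hM _
  · exact one_pos
  · exact absurd rfl ‹_›

theorem sum_mul_eq_sum_range_extendByOne {m : ℕ} {M : Matrix (Fin m) (Fin m) ℝ}
    (hM : M.IsLowerTriangular) (b : ℕ → ℝ) (i : Fin m) :
    ∑ l, M i l * b l = ∑ l ∈ Finset.range (i + 1), extendByOne M i l * b l := by
  have h1 : ∀ l : Fin m, M i l * b l = extendByOne M i l * b l := fun l => by
    simp [extendByOne]
  rw [Finset.sum_congr rfl fun l _ => h1 l,
    Fin.sum_univ_eq_sum_range (fun l => extendByOne M i l * b l) m]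
  symm
  refine Finset.sum_subset (Finset.range_mono i.2) fun l hl hl' => ?_
  have hl := Finset.mem_range.1 hl
  have hl' : (i : ℕ) < l := by simpa using hl'
  have h0 : M i ⟨l, hl⟩ = 0 := hM (show OrderDual.toDual _ < OrderDual.toDual _ from
    OrderDual.toDual_lt_toDual.2 hl')
  simp [extendByOne, hl, h0]

namespace BimodalSystem

variable {n : ℕ} {S : BimodalSystem n}

theorem convexified_subset (ξ : Fin n → ℝ) :
    S.convexified ξ ⊆ convexHull ℝ {S.field₁ ξ, S.field₂ ξ} := by
  rintro v (⟨_, rfl⟩ | ⟨_, hv⟩ | ⟨_, rfl⟩)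
  · exact subset_convexHull ℝ _ (by simp)
  · exact hv
  · exact subset_convexHull ℝ _ (by simp)

/-- Along a Filippov solution, the iterated derivatives of the output in the first mode form a
perturbed chain. -/
theorem exists_isPerturbedChain {h : ℕ} {M : Matrix (Fin (h + 2)) (Fin (h + 2)) ℝ}
    (hM : IsLowerTriangularPosDiag M)
    (hobs : obsMatrix S.c S.A₁ (h + 1) = M * obsMatrix S.c S.A₂ (h + 1))
    (hoff : offsetVector S.c S.A₁ S.e₁ S.f (h + 1) =
      Matrix.mulVec M (offsetVector S.c S.A₂ S.e₂ S.f (h + 1)))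
    {ξ : Fin n → ℝ} {x : ℝ → Fin n → ℝ} (hx : S.IsFilippovSolution ξ x) :
    ∃ C, IsPerturbedChain (h + 1) C (fun j t => outputDeriv S.c S.A₁ S.e₁ S.f j (x t))
      (fun j => deriv fun t => outputDeriv S.c S.A₁ S.e₁ S.f j (x t)) := by
  obtain ⟨C, hC1, hC⟩ := exists_abs_convex_sub_le_of_triangular (extendByOne_diag_pos hM.2) (h + 1)
  have hout : ∀ ξ, ∀ i < h + 2, outputDeriv S.c S.A₁ S.e₁ S.f i ξ =
      ∑ l ∈ Finset.range (i + 1), extendByOne M i l * outputDeriv S.c S.A₂ S.e₂ S.f l ξ := by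
    intro ξ i hi
    have h1 := obsMatrix_mulVec_add_offsetVector (c := S.c) (A := S.A₁) (e := S.e₁) (f := S.f)
      (h + 1) ξ ⟨i, hi⟩
    rw [← sum_mul_eq_sum_range_extendByOne hM.1 (fun l => outputDeriv S.c S.A₂ S.e₂ S.f l ξ)
      ⟨i, hi⟩, ← h1, hobs, hoff, ← Matrix.mulVec_mulVec, ← Matrix.mulVec_add, Matrix.mulVec]
    exact Finset.sum_congr rfl fun l _ => by rw [obsMatrix_mulVec_add_offsetVector]
  have hfun : ∀ v, ∀ i < h + 2, obsFunctional S.c S.A₁ i v =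
      ∑ l ∈ Finset.range (i + 1), extendByOne M i l * obsFunctional S.c S.A₂ l v := by
    intro v i hi
    have h1 : obsFunctional S.c S.A₁ i v =
      Matrix.mulVec (obsMatrix S.c S.A₁ (h + 1)) v ⟨i, hi⟩ := rfl
    rw [← sum_mul_eq_sum_range_extendByOne hM.1 (fun l => obsFunctional S.c S.A₂ l v)
      ⟨i, hi⟩, h1, hobs, ← Matrix.mulVec_mulVec]
    rfl
  have hac : ∀ j a b, AbsolutelyContinuousOnInterval
      (fun t => outputDeriv S.c S.A₁ S.e₁ S.f j (x t)) a b := fun j a b =>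
    (exists_lipschitzWith_outputDeriv j).choose_spec.comp_absolutelyContinuousOnInterval (hx.1 a b)
  refine ⟨C, hC1, fun j a b => (hac j a b).intervalIntegrable_deriv,
    fun j a b => (hac j a b).integral_deriv_eq_sub, ?_⟩
  filter_upwards [hx.2.2] with t ht j hj
  obtain ⟨v, hv, hxv⟩ := ht
  have hv := convexified_subset _ hv
  rw [convexHull_pair] at hv
  obtain ⟨θ, θ', h0, h0', h1, rfl⟩ := hv
  -- Applied to its own mode's field, `obsFunctional` at index `l` is by definition `outputDeriv` at
  -- `l + 1`. This produces the shifts of `a` and `b` in `hC`.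
  rw [(hasDerivAt_outputDeriv hxv j).deriv, map_add, map_smul, map_smul,
    hfun (S.field₂ (x t)) j (by omega)]
  exact hC j hj _ _ (fun i hi => hout (x t) i (by omega)) θ θ' h0 h0' h1

/-- In each alternative the convexified set reduces to the value of one continuous field, so the
a.e. equation holds everywhere on the interval. When the fields coincide, the motion is attributed
to mode 1. -/
theorem isNonSwitchingTime_of_mem_Ioo {ξ : Fin n → ℝ} {x : ℝ → Fin n → ℝ}
    (hx : S.IsFilippovSolution ξ x) {a b : ℝ}
    (H : (∀ t ∈ Ioo a b, S.output (x t) < 0) ∨ (∀ t ∈ Ioo a b, 0 < S.output (x t)) ∨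
      ∀ t ∈ Ioo a b, S.output (x t) = 0 ∧ S.field₁ (x t) = S.field₂ (x t))
    {t : ℝ} (ht : t ∈ Ioo a b) : S.IsNonSwitchingTime x t := by
  obtain ⟨ε, hε, hsub⟩ := Metric.isOpen_iff.1 isOpen_Ioo t ht
  rw [Real.ball_eq_Ioo] at hsub
  have hae : ∀ {F : (Fin n → ℝ) → Fin n → ℝ}, Continuous F →
      (∀ t ∈ Ioo a b, ∀ v ∈ S.convexified (x t), v = F (x t)) →
      ∀ s ∈ Ioo (t - ε) (t + ε), HasDerivAt x (F (x s)) s := fun hF hv s hs =>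
    hasDerivAt_of_ae_hasDerivAt hF hx.1 (by
      filter_upwards [hx.2.2] with r hr hrI
      obtain ⟨v, hvc, hd⟩ := hr
      rwa [← hv r hrI v hvc]) (hsub hs)
  refine ⟨ε, hε, ?_⟩
  rcases H with H | H | H
  · refine Or.inl fun s hs =>
      ⟨hae (F := S.field₁) continuous_affineField ?_ s hs, (H s (hsub hs)).le⟩
    rintro r hr v (⟨_, rfl⟩ | ⟨h0, _⟩ | ⟨h0, _⟩)
    · rfl
    · exact absurd h0 (H r hr).ne
    · exact absurd h0 (H r hr).not_gt
  · refine Or.inr fun s hs =>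
      ⟨hae (F := S.field₂) continuous_affineField ?_ s hs, (H s (hsub hs)).le⟩
    rintro r hr v (⟨h0, _⟩ | ⟨h0, _⟩ | ⟨_, rfl⟩)
    · exact absurd h0 (H r hr).not_gt
    · exact absurd h0 (H r hr).ne'
    · rfl
  · refine Or.inl fun s hs =>
      ⟨hae (F := S.field₁) continuous_affineField ?_ s hs, (H s (hsub hs)).1.le⟩
    intro r hr v hv
    have hv := convexified_subset _ hv
    rwa [← (H r hr).2, pair_eq_singleton, convexHull_singleton, mem_singleton_iff] at hv

end BimodalSystem

/-! ### Zeno-freeness from the trichotomy, forwards and backwards in time. -/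

theorem theorem5 {n : ℕ} (S : BimodalSystem n) (h : ℕ)
    (h_index₁ : IsObservabilityIndex S.c S.A₁ h)
    (h_index₂ : IsObservabilityIndex S.c S.A₂ h)
    (h_triangular : ∃ M : Matrix (Fin (h + 2)) (Fin (h + 2)) ℝ,
      IsLowerTriangularPosDiag M ∧
      obsMatrix S.c S.A₁ (h + 1) = M * obsMatrix S.c S.A₂ (h + 1) ∧
      offsetVector S.c S.A₁ S.e₁ S.f (h + 1) =
        Matrix.mulVec M (offsetVector S.c S.A₂ S.e₂ S.f (h + 1)))
    (h_implication : ∀ ξ : Fin n → ℝ,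
      Matrix.mulVec (obsMatrix S.c S.A₁ (h + 1)) ξ +
          offsetVector S.c S.A₁ S.e₁ S.f (h + 1) = 0 →
        Matrix.mulVec S.A₁ ξ + S.e₁ = Matrix.mulVec S.A₂ ξ + S.e₂) :
    S.IsZenoFree := by
  obtain ⟨M, hM, hobs, hoff⟩ := h_triangular
  have hzero : ∀ ξ, (∀ j ≤ h + 1, outputDeriv S.c S.A₁ S.e₁ S.f j ξ = 0) →
      S.output ξ = 0 ∧ S.field₁ ξ = S.field₂ ξ := fun ξ hξ =>
    ⟨hξ 0 (by omega), h_implication ξ (funext fun i => by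
      rw [obsMatrix_mulVec_add_offsetVector]
      exact hξ i (by omega))⟩
  constructor
  · rintro ξ x hx ⟨s, hs⟩
    obtain ⟨C, hchain⟩ := BimodalSystem.exists_isPerturbedChain hM hobs hoff hx
    have key : ∃ ε > 0, ∀ t ∈ Ioo s (s + ε), S.IsNonSwitchingTime x t := by
      -- If the whole chain vanishes at time `s`, the state `x s` is itself the common zero needed
      -- to bound the last derivative.
      rcases (hchain.shift s).trichotomy (fun h0 => by
        obtain ⟨D, hD⟩ := exists_abs_outputDeriv_le (e := S.e₁) (f := S.f) h_index₁
          (η := x (s + 0)) h0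
        exact ⟨D, fun t => hD _⟩) with ⟨ε, hε, H⟩ | ⟨ε, hε, H⟩ | H
      · refine ⟨ε, hε, fun t ht => BimodalSystem.isNonSwitchingTime_of_mem_Ioo hx
          (Or.inl fun r hr => ?_) ht⟩
        have := H (r - s) ⟨by linarith [hr.1], by linarith [hr.2]⟩
        rwa [add_sub_cancel] at this
      · refine ⟨ε, hε, fun t ht => BimodalSystem.isNonSwitchingTime_of_mem_Ioo hx
          (Or.inr (Or.inl fun r hr => ?_)) ht⟩
        have := H (r - s) ⟨by linarith [hr.1], by linarith [hr.2]⟩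
        rwa [add_sub_cancel] at this
      · refine ⟨1, one_pos, fun t ht => BimodalSystem.isNonSwitchingTime_of_mem_Ioo hx
          (Or.inr (Or.inr fun r hr => hzero _ fun j hj => ?_)) ht⟩
        have := H (r - s) (by linarith [hr.1]) j hj
        rwa [add_sub_cancel] at this
    obtain ⟨ε, hε, H⟩ := key
    obtain ⟨t, ht, hsw⟩ := hs ε hε
    exact hsw (H t ht)
  · rintro ξ x hx ⟨s, hs⟩
    obtain ⟨C, hchain⟩ := BimodalSystem.exists_isPerturbedChain hM hobs hoff hx
    have key : ∃ ε > 0, ∀ t ∈ Ioo (s - ε) s, S.IsNonSwitchingTime x t := by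
      rcases (hchain.reverse s).trichotomy (fun h0 => by
        obtain ⟨D, hD⟩ := exists_abs_outputDeriv_le (e := S.e₁) (f := S.f) h_index₁
          (η := x (s - 0)) (fun j hj => by simpa using h0 j hj)
        -- The signs from the time reversal disappear under absolute values.
        exact ⟨D, fun t => by simpa [abs_mul] using hD (x (s - t))⟩)
        with ⟨ε, hε, H⟩ | ⟨ε, hε, H⟩ | H
      · refine ⟨ε, hε, fun t ht => BimodalSystem.isNonSwitchingTime_of_mem_Ioo hx
          (Or.inl fun r hr => ?_) ht⟩
        have := H (s - r) ⟨by linarith [hr.2], by linarith [hr.1]⟩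
        rwa [sub_sub_cancel, pow_zero, one_mul] at this
      · refine ⟨ε, hε, fun t ht => BimodalSystem.isNonSwitchingTime_of_mem_Ioo hx
          (Or.inr (Or.inl fun r hr => ?_)) ht⟩
        have := H (s - r) ⟨by linarith [hr.2], by linarith [hr.1]⟩
        rwa [sub_sub_cancel, pow_zero, one_mul] at this
      · refine ⟨1, one_pos, fun t ht => BimodalSystem.isNonSwitchingTime_of_mem_Ioo hx
          (Or.inr (Or.inr fun r hr => hzero _ fun j hj => ?_)) ht⟩
        have := H (s - r) (by linarith [hr.2]) j hj
        rw [sub_sub_cancel] at this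
        exact (mul_eq_zero.1 this).resolve_left (pow_ne_zero _ (by norm_num))
    obtain ⟨ε, hε, H⟩ := key
    obtain ⟨t, ht, hsw⟩ := hs ε hε
    exact hsw (H t ht)
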